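/- Let $Q$ and $X$ be affine algebraic varieties over $\mathbb{C}$ (reduced, possibly reducible), let $m\ge 0$, and let $X_0=Q\times\mathbb{C}^m$ with coordinates $\bar u=(u_1,\dots,u_m)$ on $\mathbb{C}^m$. Let $g\in\mathbb{C}[Q]$ and let $\varphi:X\to X_0$ be an affine modification with divisor $D=\{g=0\}\subset X_0$; that is, $\varphi$ is a morphism of varieties over $\mathbb{C}$, the open sets $X_0\setminus D$ and $X\setminus\varphi^{-1}(D)$ are dense in $X_0$ and $X$, and $\varphi$ restricts to an isomorphism $X\setminus\varphi^{-1}(D)\to X_0\setminus D$. Then there is a natural number $k_0$, depending only on these data, such that the following holds for every $k\ge k_0$ and every $f\in\mathbb{C}[Q]$ which vanishes identically on no irreducible component of $Q$, has no common zeros with $g$, and equals $1$ on $D$ with multiplicity $k$, i.e. $f-1\in g^k\,\mathbb{C}[Q]$. Let $Z_0\subset X_0$ be the closed subscheme given by the equations $u_1=\dots=u_m=0$ and $f=0$, let $Z=\varphi^{-1}(Z_0)\subset X$ be its (scheme-theoretic) preimage, let $\pi:\tilde X\to X$ be the blowing up of $X$ along $Z$, and let $E=\pi^{-1}(Z)$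 be its exceptional divisor. Then $\tilde X$ contains a Zariski open subset $X'$ which is isomorphic to $X$ (over $\mathbb{C}$) and for which $X'\cap E$ is dense in $E$. -/

import Mathlib

open CategoryTheory AlgebraicGeometry TopologicalSpace

/-! ### The blowing up of an affine scheme -/

namespace ReesGrading

variable {R : Type} [CommRing R] (I : Ideal R)

/-- The degree `n` part `Iⁿ tⁿ` of the Rees algebra `R[It] = ⨁ₙ Iⁿ tⁿ`. -/
def piece (n : ℕ) : Submodule R (reesAlgebra I) where
  carrier := {p | ∀ i : ℕ, i ≠ n → (p : Polynomial R).coeff i = 0}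
  add_mem' hp hq i hi := by
    simp [hp i hi, hq i hi]
  zero_mem' _ _ := by simp
  smul_mem' r p hp i hi := by
    simp [hp i hi]

/-- The homogeneous component of degree `n` of an element of the Rees algebra. -/
noncomputable def component (n : ℕ) (p : reesAlgebra I) : piece I n :=
  ⟨⟨Polynomial.monomial n ((p : Polynomial R).coeff n),
    reesAlgebra.monomial_mem.mpr (p.2 n)⟩,
   fun i hi => Polynomial.coeff_monomial_of_ne _ hi⟩

theorem sum_component (p : reesAlgebra I) :
    ∑ n ∈ (p : Polynomial R).support, ((component I n p : piece I n) : reesAlgebra I) = p := by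
  apply Subtype.ext
  rw [AddSubmonoidClass.coe_finsetSum]
  exact (p : Polynomial R).as_sum_support.symm

theorem coeff_coeAddMonoidHom (i : ℕ) (y : DirectSum ℕ fun n => piece I n) :
    ((DirectSum.coeAddMonoidHom (piece I) y : reesAlgebra I) : Polynomial R).coeff i =
      (((y i : piece I i) : reesAlgebra I) : Polynomial R).coeff i := by
  induction y using DirectSum.induction_on with
  | zero => simp
  | of j z =>
    rw [DirectSum.coeAddMonoidHom_of]
    by_cases hj : j = i
    · subst hj; rw [DirectSum.of_eq_same]
    · rw [DirectSum.of_eq_of_ne _ _ _ (Ne.symm hj), z.2 i (Ne.symm hj)]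
      rfl
  | add a b ha hb =>
    rw [map_add, DirectSum.add_apply]
    simp [ha, hb]

theorem isInternal : DirectSum.IsInternal (piece I) := by
  constructor
  · intro x y hxy
    refine DFinsupp.ext fun n => Subtype.ext (Subtype.ext (Polynomial.ext fun i => ?_))
    by_cases hi : i = n
    · subst hi
      have hx := coeff_coeAddMonoidHom I i x
      have hy := coeff_coeAddMonoidHom I i y
      exact hx.symm.trans ((congrArg (fun z : reesAlgebra I => (z : Polynomial R).coeff i) hxy).trans hy)
    · exact ((x n).2 i hi).trans ((y n).2 i hi).symm
  · intro p
    refine ⟨∑ n ∈ (p : Polynomial R).support,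
      DirectSum.of (fun n => piece I n) n (component I n p), ?_⟩
    rw [map_sum]
    simp only [DirectSum.coeAddMonoidHom_of]
    exact sum_component I p

/-- The Rees algebra is graded by its pieces `Iⁿ tⁿ`. -/
noncomputable instance : GradedRing (piece I) where
  one_mem i hi := by
    simp [Polynomial.coeff_one, hi]
  mul_mem {a b} p q hp hq i hi := by
    change ((p : Polynomial R) * (q : Polynomial R)).coeff i = 0
    rw [Polynomial.coeff_mul]
    refine Finset.sum_eq_zero fun x hx => ?_
    have hx' : x.1 + x.2 = i := Finset.HasAntidiagonal.mem_antidiagonal.mp hx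
    by_cases h1 : x.1 = a
    · rw [hq x.2 (by rintro h2; exact hi (by omega)), mul_zero]
    · rw [hp x.1 h1, zero_mul]
  toDecomposition := (isInternal I).chooseDecomposition

end ReesGrading

/-- The blowing up `Proj (⨁ₙ Iⁿ)` of an affine scheme `X` along the closed subscheme
defined by an ideal `I` of its coordinate ring. -/
noncomputable def blowup (X : Scheme.{0}) (I : Ideal Γ(X, ⊤)) : Scheme.{0} :=
  Proj (ReesGrading.piece I)

/-- The structure morphism `π : blowup X I ⟶ X` of the blowing up. -/
noncomputable def blowupπ (X : Scheme.{0}) [IsAffine X] (I : Ideal Γ(X, ⊤)) :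
    blowup X I ⟶ X :=
  Proj.toSpecZero (ReesGrading.piece I) ≫
    Spec.map (CommRingCat.ofHom (algebraMap Γ(X, ⊤) (ReesGrading.piece I 0))) ≫
    X.isoSpec.inv

/-- The exceptional divisor `E = π⁻¹(Z)` of the blowing up of `X` along `Z = V(I)`, as a
closed subset of the blowing up. -/
def exceptionalSet (X : Scheme.{0}) [IsAffine X] (I : Ideal Γ(X, ⊤)) : Set (blowup X I) :=
  blowupπ X I ⁻¹' X.zeroLocus (I : Set Γ(X, ⊤))

/-! ### Affine modifications and the center -/

/-- A morphism `φ : X ⟶ Y` of affine varieties is an affine modification with (principal) divisor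
`D = {g = 0} ⊆ Y` and exceptional divisor `φ⁻¹(D) ⊆ X`: the complements of the two divisors are
dense, and `φ` restricts to an isomorphism between them. In particular, `φ` is birational. -/
structure IsAffineModification {X Y : Scheme.{0}} (φ : X ⟶ Y) (g : Γ(Y, ⊤)) : Prop where
  dense_target : Dense (Y.basicOpen g : Set Y)
  dense_source : Dense (φ ⁻¹ᵁ Y.basicOpen g : Set X)
  isIso_restrict : IsIso (φ ∣_ Y.basicOpen g)

/-- The regular function on `Q × ℂᵐ` induced by a regular function on `Q`. -/
noncomputable def liftFun {Q : Scheme.{0}} (m : ℕ) (h : Γ(Q, ⊤)) : Γ(𝔸(Fin m; Q), ⊤) :=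
  (𝔸(Fin m; Q) ↘ Q).appTop h

/-- The ideal of the closed subscheme `Z₀ = {u₁ = ⋯ = uₘ = 0, f = 0}` of `Q × ℂᵐ`. -/
noncomputable def centerIdeal {Q : Scheme.{0}} (m : ℕ) (f : Γ(Q, ⊤)) :
    Ideal Γ(𝔸(Fin m; Q), ⊤) :=
  Ideal.span (Set.range (AffineSpace.coord Q : Fin m → Γ(𝔸(Fin m; Q), ⊤)) ∪ {liftFun m f})

/-- The ideal of the scheme-theoretic preimage of `Z₀` under `φ : X ⟶ Q × ℂᵐ`. -/
noncomputable def preimageIdeal {Q X : Scheme.{0}} {m : ℕ} (φ : X ⟶ 𝔸(Fin m; Q))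
    (f : Γ(Q, ⊤)) : Ideal Γ(X, ⊤) :=
  (centerIdeal m f).map φ.appTop.hom

/-! ### Algebra of the center -/

section Algebra

open MvPolynomial

/-! Write `A = ℂ[Q]`, `B = ℂ[X]`, and let `L` be the total ring of fractions of `A`. Density and
reducedness make `g` and `f` nonzerodivisors, and the modification gives `A[u] ⊆ B ⊆ A[u][1/g] ⊆
L[u]`. Take `X'` to be the chart of the blowing up where `f t` is invertible; its ring is `B[u₁/f,
…, uₘ/f]` inside `L[u]`.

The dilation `uᵢ ↦ f uᵢ` of `L[u]` sends `uᵢ/f` to `uᵢ`. A generator `p/gᴺ` of `B` moves by `(p(fu)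
- p(u))/gᴺ`. The numerator is divisible by `f - 1`, hence by `gᴺ` once `k ≥ N`, so the generator
changes only by an element of `A[u]`. Thus the dilation carries the chart ring onto `B` and fixes
`A` (`map_dilation_adjoin`, `exists_chart_equiv`). As `B` is finitely generated over `A`, one `N`
serves all generators.

Density of `X' ∩ E` in `E` follows once `f t` is a nonzerodivisor modulo the ideal that `I`
generates in the Rees algebra, that is, `(Iⁿ⁺¹ : f) = Iⁿ` (`mem_closure_basicOpen_inter`). In `A[u]`
this is read off coefficients (`mem_span_X_C_pow_of_mul_mem`); it passes to `B` because `f` and `g`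
are comaximal (`Ideal.mem_map_pow_of_mul_mem`). -/

theorem MvPolynomial.C_sub_one_dvd_dilate_sub {σ A : Type*} [CommRing A] (f : A)
    (p : MvPolynomial σ A) :
    C (f - 1) ∣ aeval (fun i => C f * X i : σ → MvPolynomial σ A) p - p := by
  rw [← Ideal.mem_span_singleton, ← Ideal.Quotient.eq]
  set J : Ideal (MvPolynomial σ A) := Ideal.span {C (f - 1)}
  -- Modulo `f - 1` the dilation fixes every variable, so it is the identity.
  have h : (Ideal.Quotient.mkₐ A J).comp (aeval (fun i => C f * X i : σ → MvPolynomial σ A)) =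
      Ideal.Quotient.mkₐ A J := by
    ext i
    simp only [AlgHom.comp_apply, aeval_X, Ideal.Quotient.mkₐ_eq_mk]
    rw [Ideal.Quotient.eq, Ideal.mem_span_singleton]
    exact ⟨X i, by rw [map_sub, map_one]; ring⟩
  exact DFunLike.congr_fun h p

/-- Powers of the ideal `(u₁, …, uₘ, f)` in `A[u₁, …, uₘ]`, described by coefficients. -/
theorem MvPolynomial.mem_span_X_C_pow_iff {σ A : Type*} [CommRing A] (f : A) (n : ℕ)
    (p : MvPolynomial σ A) :
    p ∈ Ideal.span (Set.range X ∪ {C f}) ^ n ↔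
      ∀ d : σ →₀ ℕ, f ^ (n - d.degree) ∣ p.coeff d := by
  classical
  constructor
  · intro hp
    induction n generalizing p with
    | zero => simp
    | succ n ih =>
      rw [pow_succ] at hp
      induction hp using Submodule.mul_induction_on' with
      | add x _ y _ hx hy => intro d; rw [coeff_add]; exact dvd_add (hx d) (hy d)
      | mem_mul_mem a ha b hb =>
        induction hb using Submodule.span_induction with
        | zero => simp
        | add x y _ _ hx hy => intro d; rw [mul_add, coeff_add]; exact dvd_add (hx d) (hy d)
        | smul c x _ hx =>
          intro d
          rw [smul_eq_mul, mul_left_comm, coeff_mul]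
          refine Finset.dvd_sum fun e he => (Dvd.dvd.mul_left ?_ _)
          have h1 : e.1.degree + e.2.degree = d.degree := by
            rw [← map_add, Finset.HasAntidiagonal.mem_antidiagonal.mp he]
          exact (pow_dvd_pow f (by omega)).trans (hx e.2)
        | mem x hx =>
          intro d
          rcases hx with ⟨i, rfl⟩ | rfl
          · rw [coeff_mul_X']
            split_ifs with h
            · have h1 : (d - Finsupp.single i 1).degree + 1 = d.degree := by
                have h2 : d - Finsupp.single i 1 + Finsupp.single i 1 = d := by
                  refine tsub_add_cancel_of_le ?_
                  rw [Finsupp.single_le_iff]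
                  exact Nat.one_le_iff_ne_zero.mpr (Finsupp.mem_support_iff.mp h)
                conv_rhs => rw [← h2]
                rw [map_add, Finsupp.degree_single]
              refine (pow_dvd_pow f ?_).trans (ih a ha _)
              omega
            · exact dvd_zero _
          · rw [mul_comm, coeff_C_mul]
            refine (pow_dvd_pow f (show _ ≤ (n - d.degree) + 1 by omega)).trans ?_
            rw [pow_succ']
            exact mul_dvd_mul_left _ (ih a ha d)
  · intro h
    rw [p.as_sum]
    refine Ideal.sum_mem _ fun d _ => ?_
    set I : Ideal (MvPolynomial σ A) := Ideal.span (Set.range X ∪ {C f})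
    obtain ⟨c, hc⟩ := h d
    have hX : (monomial d (1 : A)) ∈ I ^ d.degree := by
      rw [monomial_eq, C_1, one_mul, Finsupp.degree_apply, ← Finset.prod_pow_eq_pow_sum]
      refine Ideal.prod_mem_prod fun i _ => Ideal.pow_mem_pow ?_ _
      exact Ideal.subset_span (Or.inl ⟨i, rfl⟩)
    have hf : (C f : MvPolynomial σ A) ∈ I := Ideal.subset_span (Or.inr rfl)
    have : monomial d (p.coeff d) = C c * (C f ^ (n - d.degree) * monomial d 1) := by
      rw [hc, ← map_pow, C_mul_monomial, C_mul_monomial]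
      congr 1; ring
    rw [this]
    refine Ideal.mul_mem_left _ _ ?_
    have hmul := Ideal.mul_mem_mul (Ideal.pow_mem_pow hf (n - d.degree)) hX
    rw [← pow_add] at hmul
    -- The subtraction is truncated, so `(n - |d|) + |d|` is only at least `n`.
    exact Ideal.pow_le_pow_right (by omega) hmul

/-- One factor `f` cancels from each coefficient condition; for `n ≤ |d|` the condition is void. -/
theorem MvPolynomial.mem_span_X_C_pow_of_mul_mem {σ A : Type*} [CommRing A] {f : A}
    (hf : f ∈ nonZeroDivisors A) {n : ℕ} {p : MvPolynomial σ A}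
    (h : C f * p ∈ Ideal.span (Set.range X ∪ {C f}) ^ (n + 1)) :
    p ∈ Ideal.span (Set.range X ∪ {C f}) ^ n := by
  rw [mem_span_X_C_pow_iff] at h ⊢
  intro d
  have hd := h d
  rw [coeff_C_mul] at hd
  by_cases hn : n ≤ d.degree
  · simp [Nat.sub_eq_zero_of_le hn]
  · rw [show n + 1 - d.degree = n - d.degree + 1 by omega, pow_succ'] at hd
    obtain ⟨c, hc⟩ := hd
    refine ⟨c, ?_⟩
    rw [mul_assoc] at hc
    exact (mul_cancel_left_mem_nonZeroDivisors hf).mp hc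

/-- If `ψ : R → B` is birational with denominators powers of `g`, and `I` is an ideal of `R` whose
extension to `B` is comaximal with `g`, then the colon property `(Iⁿ⁺¹ : f) = Iⁿ` passes from `R`
to `B`. -/
theorem Ideal.mem_map_pow_of_mul_mem {R B : Type*} [CommRing R] [CommRing B] (ψ : R →+* B)
    (hψ : Function.Injective ψ) (g f : R) (hloc : ∀ b : B, ∃ (n : ℕ) (r : R), ψ g ^ n * b = ψ r)
    (I : Ideal R) (hfI : f ∈ I) (hfg : IsCoprime f g)
    (hI : ∀ (n : ℕ) (p : R), f * p ∈ I ^ (n + 1) → p ∈ I ^ n) (n : ℕ) (b : B)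
    (hb : ψ f * b ∈ I.map ψ ^ (n + 1)) : b ∈ I.map ψ ^ n := by
  -- A power of `g` clears the denominators of the coefficients in `B`.
  have key : ∀ y ∈ (I ^ (n + 1)).map ψ, ∃ (M : ℕ) (x : R), x ∈ I ^ (n + 1) ∧ ψ g ^ M * y = ψ x := by
    intro y hy
    induction hy using Submodule.span_induction with
    | mem y hy => obtain ⟨x, hx, rfl⟩ := hy; exact ⟨0, x, hx, by simp⟩
    | zero => exact ⟨0, 0, zero_mem _, by simp⟩
    | add y z _ _ hy hz =>
      obtain ⟨M, x, hx, e⟩ := hy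
      obtain ⟨N, w, hw, e'⟩ := hz
      refine ⟨M + N, g ^ N * x + g ^ M * w,
        add_mem (Ideal.mul_mem_left _ _ hx) (Ideal.mul_mem_left _ _ hw), ?_⟩
      rw [map_add, map_mul, map_mul, ← e, ← e', map_pow, map_pow]; ring
    | smul c y _ hy =>
      obtain ⟨M, x, hx, e⟩ := hy
      obtain ⟨N, w, e'⟩ := hloc c
      refine ⟨N + M, w * x, Ideal.mul_mem_left _ _ hx, ?_⟩
      rw [map_mul, ← e, ← e', smul_eq_mul]; ring
  rw [← Ideal.map_pow] at hb ⊢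
  obtain ⟨M, x, hx, e⟩ := key _ hb
  obtain ⟨N, r, hr⟩ := hloc b
  have hmem : ψ g ^ (M + N) * b ∈ (I ^ n).map ψ := by
    have h1 : f * (g ^ M * r) = g ^ N * x := by
      apply hψ
      rw [map_mul, map_mul, map_mul, map_pow, map_pow, ← hr, ← e]; ring
    have h2 := hI n (g ^ M * r) (h1 ▸ Ideal.mul_mem_left _ _ hx)
    have := Ideal.mem_map_of_mem ψ h2
    rwa [map_mul, map_pow, ← hr, ← mul_assoc, ← pow_add] at this
  -- Both `fⁿ b` and `g^(M+N) b` lie in the extended `Iⁿ`, and `fⁿ`, `g^(M+N)` are comaximal.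
  obtain ⟨s, t, hst⟩ := hfg.pow (m := n) (n := M + N)
  have hb1 : b = ψ s * ψ (f ^ n) * b + ψ t * (ψ g ^ (M + N) * b) := by
    have := congrArg ψ hst
    rw [map_add, map_mul, map_mul, map_one, map_pow ψ g] at this
    linear_combination (-b) * this
  rw [hb1]
  refine add_mem (Ideal.mul_mem_right _ _ (Ideal.mul_mem_left _ _
    (Ideal.mem_map_of_mem ψ (Ideal.pow_mem_pow hfI n)))) (Ideal.mul_mem_left _ _ hmem)

/-- The dilation `uᵢ ↦ f uᵢ` of `L[u]`. -/
noncomputable def MvPolynomial.dilation {σ : Type*} (A : Type*) {L : Type*} [CommRing A]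
    [CommRing L] [Algebra A L] (f : A) : MvPolynomial σ L →ₐ[A] MvPolynomial σ L :=
  (aeval (fun i => C (algebraMap A L f) * X i : σ → MvPolynomial σ L)).restrictScalars A

theorem MvPolynomial.dilation_X {σ A L : Type*} [CommRing A] [CommRing L] [Algebra A L] (f : A)
    (i : σ) : dilation A f (X i : MvPolynomial σ L) = C (algebraMap A L f) * X i := by
  simp [dilation]

theorem MvPolynomial.dilation_C {σ A L : Type*} [CommRing A] [CommRing L] [Algebra A L] (f : A)
    (l : L) : dilation A f (C l : MvPolynomial σ L) = C l := by
  simp [dilation, algebraMap_eq]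

theorem MvPolynomial.dilation_injective {σ A L : Type*} [CommRing A] [CommRing L] [Algebra A L]
    {f : A} (hf : IsUnit (algebraMap A L f)) :
    Function.Injective (dilation A f : MvPolynomial σ L → MvPolynomial σ L) := by
  obtain ⟨v, hv⟩ := hf.exists_left_inv
  refine Function.LeftInverse.injective
    (g := aeval (fun i => C v * X i : σ → MvPolynomial σ L)) fun p => ?_
  have : (aeval (fun i => C v * X i : σ → MvPolynomial σ L)).comp
      (aeval (fun i => C (algebraMap A L f) * X i : σ → MvPolynomial σ L)) = AlgHom.id L _ := by
    ext i : 1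
    simp only [AlgHom.comp_apply, aeval_X, map_mul, algHom_C, algebraMap_eq, AlgHom.id_apply]
    rw [← mul_assoc, ← C_mul, mul_comm _ v, hv, C_1, one_mul]
  exact DFunLike.congr_fun this p

/-- Brings the dilation back to coefficients in `A`: divisibility by `f - 1` or `g` must be used
there, since `g` is a unit in `L`. -/
theorem MvPolynomial.dilation_map {σ A L : Type*} [CommRing A] [CommRing L] [Algebra A L] (f : A)
    (p : MvPolynomial σ A) : dilation A f (MvPolynomial.map (algebraMap A L) p) =
      MvPolynomial.map (algebraMap A L) (aeval (fun i => C f * X i : σ → MvPolynomial σ A) p) := by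
  have : ((dilation A f : MvPolynomial σ L →ₐ[A] _).comp (mapAlgHom (Algebra.ofId A L))) =
      (mapAlgHom (Algebra.ofId A L)).comp
        (aeval (fun i => C f * X i : σ → MvPolynomial σ A)) := by
    ext i : 1
    simp [dilation_X, mapAlgHom_apply]
  exact DFunLike.congr_fun this p

/-- Dilation by `f` carries the chart `B[u₁/f, …, uₘ/f]` of the blowing up onto `B`, provided
`f` is congruent to `1` modulo a high power of `g`. -/
theorem MvPolynomial.map_dilation_adjoin {σ A L B : Type*} [CommRing A] [CommRing L] [Algebra A L]
    [CommRing B] [Algebra A B] (j : B →ₐ[A] MvPolynomial σ L)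
    (u : σ → B) (hu : ∀ i, j (u i) = X i) (f g : A) (v : L) (hv : v * algebraMap A L f = 1)
    (hg : IsUnit (algebraMap A L g)) (T : Set B) (hT : Algebra.adjoin A T = ⊤) (N k : ℕ)
    (hN : ∀ b ∈ T, ∃ p : MvPolynomial σ A,
      C (algebraMap A L g) ^ N * j b = MvPolynomial.map (algebraMap A L) p)
    (hk : N ≤ k) (hf : g ^ k ∣ f - 1) :
    (Algebra.adjoin A (j '' T ∪ Set.range fun i => C v * X i)).map (dilation A f) = j.range := by
  have hX : ∀ i, dilation A f (C v * X i : MvPolynomial σ L) = X i := fun i => by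
    rw [map_mul, dilation_C, dilation_X, ← mul_assoc, ← C_mul, hv, C_1, one_mul]
  have hmapj : ∀ p : MvPolynomial σ A,
      MvPolynomial.map (algebraMap A L) p = j (aeval u p) := fun p => by
    have : mapAlgHom (Algebra.ofId A L) = j.comp (aeval u) := by
      ext i : 1
      simp [hu, mapAlgHom_apply]
    exact DFunLike.congr_fun this p
  set S := Algebra.adjoin A (j '' T ∪ Set.range fun i => C v * X i)
  have hmapS : ∀ p : MvPolynomial σ A,
      MvPolynomial.map (algebraMap A L) p ∈ S.map (dilation A f) := fun p => by
    refine ⟨aeval (fun i => C v * X i : σ → MvPolynomial σ L) p, ?_, ?_⟩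
    · refine Algebra.adjoin_mono Set.subset_union_right ?_
      rw [Algebra.adjoin_range_eq_range_aeval]
      exact ⟨p, rfl⟩
    · change dilation A f _ = _
      have : (dilation A f).comp (aeval (fun i => C v * X i : σ → MvPolynomial σ L)) =
          mapAlgHom (Algebra.ofId A L) := by
        ext i : 1
        simp only [AlgHom.comp_apply, aeval_X, hX]
        simp [mapAlgHom_apply]
      exact DFunLike.congr_fun this p
  -- The factor `gᴺ` in `f - 1` cancels the denominator of `p(fu) - p(u)`.
  have hdiff : ∀ b ∈ T, ∃ q : MvPolynomial σ A,
      dilation A f (j b) = j b + MvPolynomial.map (algebraMap A L) q := fun b hb => by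
    obtain ⟨p, hp⟩ := hN b hb
    obtain ⟨q, hq⟩ := C_sub_one_dvd_dilate_sub f p
    obtain ⟨h, hh⟩ := hf
    obtain ⟨d, rfl⟩ := Nat.exists_eq_add_of_le hk
    refine ⟨C (g ^ d * h) * q, ?_⟩
    refine ((hg.map C).pow N).mul_left_cancel ?_
    have h1 := congrArg (dilation A f) hp
    rw [map_mul, map_pow, dilation_C, dilation_map] at h1
    rw [h1, mul_add, hp, ← sub_eq_iff_eq_add', ← map_sub, hq, hh]
    simp only [map_mul, map_pow, map_C, pow_add]
    ring
  apply le_antisymm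
  · rw [AlgHom.map_adjoin, Algebra.adjoin_le_iff]
    rintro _ ⟨_, ⟨b, hb, rfl⟩ | ⟨i, rfl⟩, rfl⟩
    · obtain ⟨q, hq⟩ := hdiff b hb
      exact ⟨b + aeval u q, by rw [hq, hmapj]; exact map_add j _ _⟩
    · exact ⟨u i, by rw [hX]; exact hu i⟩
  · rw [← Algebra.map_top, ← hT, AlgHom.map_adjoin, Algebra.adjoin_le_iff]
    rintro _ ⟨b, hb, rfl⟩
    obtain ⟨q, hq⟩ := hdiff b hb
    rw [← sub_eq_iff_eq_add] at hq
    rw [← hq]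
    exact sub_mem ⟨j b, Algebra.subset_adjoin (Or.inl ⟨b, hb, rfl⟩), rfl⟩ (hmapS q)

end Algebra

/-! ### A chart of the blowing up -/

namespace ReesGrading

open HomogeneousLocalization

variable {R : Type} [CommRing R] {I : Ideal R}

/-- The element `f t` of the Rees algebra. -/
noncomputable def degreeOne (f : R) (hf : f ∈ I) : reesAlgebra I :=
  ⟨Polynomial.monomial 1 f, reesAlgebra.monomial_mem.mpr (by simpa using hf)⟩

theorem degreeOne_mem (f : R) (hf : f ∈ I) : degreeOne f hf ∈ piece I 1 :=
  fun _ hi => Polynomial.coeff_monomial_of_ne _ hi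

theorem eq_monomial_of_mem_piece {n : ℕ} {x : reesAlgebra I} (hx : x ∈ piece I n) :
    (x : Polynomial R) = Polynomial.monomial n ((x : Polynomial R).coeff n) := by
  ext i
  rw [Polynomial.coeff_monomial]
  split_ifs with h
  · rw [h]
  · exact hx i (Ne.symm h)

variable {K : Type*} [CommRing K] (j : R →+* K) {f : R} (hf : f ∈ I) {v : K} (hv : v * j f = 1)

/-- The homomorphism to `K` from the coordinate ring of the chart of the blowing up given by
`f ∈ I`, for a homomorphism `R → K` which sends `f` to a unit with inverse `v`. -/
noncomputable def chartMap : Away (piece I) (degreeOne f hf) →+* K :=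
  (IsLocalization.Away.lift (S := Localization.Away (degreeOne f hf)) (degreeOne f hf)
    -- Evaluating `t` at `v = 1/f` sends `f t` to `1`.
    (g := (Polynomial.eval₂RingHom j v).comp (reesAlgebra I).val.toRingHom)
    (by
      have : (Polynomial.eval₂RingHom j v).comp (reesAlgebra I).val.toRingHom (degreeOne f hf) =
          1 := by
        simp [degreeOne, mul_comm (j f), hv]
      rw [this]; exact isUnit_one)).comp (algebraMap _ _)

theorem chartMap_mk (n : ℕ) (x : reesAlgebra I) (hx : x ∈ piece I (n • 1)) :
    chartMap j hf hv (Away.mk (piece I) (degreeOne_mem f hf) n x hx) =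
      v ^ n * j ((x : Polynomial R).coeff n) := by
  have hx' : (x : Polynomial R) = Polynomial.monomial n ((x : Polynomial R).coeff n) :=
    eq_monomial_of_mem_piece (by simpa using hx)
  rw [chartMap, RingHom.comp_apply, HomogeneousLocalization.algebraMap_apply, Away.val_mk,
    Localization.mk_eq_mk', IsLocalization.Away.lift, IsLocalization.lift_mk'_spec]
  have h1 : (Polynomial.eval₂RingHom j v).comp (reesAlgebra I).val.toRingHom x =
      v ^ n * j ((x : Polynomial R).coeff n) := by
    change Polynomial.eval₂ j v (x : Polynomial R) = _
    conv_lhs => rw [hx']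
    rw [Polynomial.eval₂_monomial, mul_comm]
  rw [h1, map_pow]
  simp [degreeOne, mul_comm (j f), hv]

theorem chartMap_fromZeroRingHom (r : R) :
    chartMap j hf hv (fromZeroRingHom (piece I) _ (algebraMap R (piece I 0) r)) = j r := by
  have : fromZeroRingHom (piece I) (Submonoid.powers (degreeOne f hf))
      (algebraMap R (piece I 0) r) = Away.mk (piece I) (degreeOne_mem f hf) 0
        (algebraMap R (piece I 0) r : piece I 0)
        (by rw [zero_smul]; exact (algebraMap R (piece I 0) r).2) := by
    apply HomogeneousLocalization.val_injective
    rw [Away.val_mk]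
    simp only [pow_zero]
    rfl
  rw [this, chartMap_mk, pow_zero, one_mul]
  congr 1
  exact Polynomial.coeff_C_zero

theorem mem_range_chartMap (k : K) :
    k ∈ Set.range (chartMap j hf hv) ↔ ∃ (n : ℕ) (s : R), s ∈ I ^ n ∧ v ^ n * j s = k := by
  constructor
  · rintro ⟨c, rfl⟩
    obtain ⟨n, x, hx, rfl⟩ := Away.mk_surjective (piece I) (degreeOne_mem f hf) c
    exact ⟨n, _, x.2 n, (chartMap_mk j hf hv n x hx).symm⟩
  · rintro ⟨n, s, hs, rfl⟩
    refine ⟨Away.mk (piece I) (degreeOne_mem f hf) n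
      ⟨Polynomial.monomial n s, reesAlgebra.monomial_mem.mpr hs⟩ ?_, ?_⟩
    · rw [smul_eq_mul, mul_one]
      exact fun _ hi => Polynomial.coeff_monomial_of_ne _ hi
    · rw [chartMap_mk]
      simp

theorem chartMap_injective (hj : Function.Injective j) :
    Function.Injective (chartMap j hf hv) := by
  rw [injective_iff_map_eq_zero]
  intro c hc
  obtain ⟨n, x, hx, rfl⟩ := Away.mk_surjective (piece I) (degreeOne_mem f hf) c
  rw [chartMap_mk] at hc
  have hu : IsUnit (v ^ n) := (IsUnit.of_mul_eq_one _ hv).pow n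
  rw [hu.mul_right_eq_zero, map_eq_zero_iff j hj] at hc
  have hx0 : x = 0 := by
    apply Subtype.ext
    rw [eq_monomial_of_mem_piece (n := n) (by simpa using hx), hc]
    simp
  apply HomogeneousLocalization.val_injective
  rw [Away.val_mk, hx0, Localization.mk_zero, HomogeneousLocalization.val_zero]

/-- As `I` is generated by the `w i` and `f`, the set `v I` lies in the algebra on the right, hence
so does `vⁿ Iⁿ`. -/
theorem range_chartMap_eq_adjoin {A ι : Type*} [CommRing A] [Algebra A R] [Algebra A K]
    (j : R →ₐ[A] K) (hv : v * j.toRingHom f = 1) (w : ι → R)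
    (hI : I = Ideal.span (Set.range w ∪ {f})) (T : Set R) (hT : Algebra.adjoin A T = ⊤) :
    Set.range (chartMap j.toRingHom hf hv) =
      (Algebra.adjoin A (j '' T ∪ Set.range fun i => v * j (w i)) : Set K) := by
  ext k
  constructor
  · rw [mem_range_chartMap]
    rintro ⟨n, s, hs, rfl⟩
    set S := Algebra.adjoin A (j '' T ∪ Set.range fun i => v * j (w i))
    have hjS : ∀ b, j b ∈ S := fun b => by
      have h1 : b ∈ Algebra.adjoin A T := hT ▸ Algebra.mem_top
      have h2 : j b ∈ (Algebra.adjoin A T).map j := ⟨b, h1, rfl⟩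
      rw [AlgHom.map_adjoin] at h2
      exact Algebra.adjoin_mono Set.subset_union_left h2
    have hIS : ∀ b ∈ I, v * j b ∈ S := fun b hb => by
      rw [hI] at hb
      induction hb using Submodule.span_induction with
      | mem b hb =>
        rcases hb with ⟨i, rfl⟩ | rfl
        · exact Algebra.subset_adjoin (Or.inr ⟨i, rfl⟩)
        · exact (show v * j b = 1 from hv) ▸ one_mem S
      | zero => simp
      | add x y _ _ hx hy => rw [map_add, mul_add]; exact add_mem hx hy
      | smul c x _ hx => rw [smul_eq_mul, map_mul, mul_left_comm]; exact mul_mem (hjS c) hx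
    change v ^ n * j s ∈ S
    induction n generalizing s with
    | zero => simpa using hjS s
    | succ n ih =>
      rw [pow_succ] at hs
      induction hs using Submodule.mul_induction_on' with
      | mem_mul_mem a ha b hb =>
        rw [map_mul, pow_succ, mul_mul_mul_comm]
        exact mul_mem (ih a ha) (hIS b hb)
      | add x _ y _ hx hy => rw [map_add, mul_add]; exact add_mem hx hy
  · intro hk
    induction hk using Algebra.adjoin_induction with
    | mem k hk =>
      rcases hk with ⟨b, -, rfl⟩ | ⟨i, rfl⟩
      · exact (mem_range_chartMap _ hf hv _).mpr ⟨0, b, by simp, by simp⟩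
      · refine (mem_range_chartMap _ hf hv _).mpr ⟨1, w i, ?_, by simp⟩
        rw [pow_one, hI]
        exact Ideal.subset_span (Or.inl ⟨i, rfl⟩)
    | algebraMap a =>
      exact (mem_range_chartMap _ hf hv _).mpr ⟨0, algebraMap A R a, by simp, by simp⟩
    | add x y _ _ hx hy =>
      obtain ⟨⟨a, rfl⟩, b, rfl⟩ := And.intro hx hy
      exact ⟨a + b, map_add _ _ _⟩
    | mul x y _ _ hx hy =>
      obtain ⟨⟨a, rfl⟩, b, rfl⟩ := And.intro hx hy
      exact ⟨a * b, map_mul _ _ _⟩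

/-- Membership in the ideal generated by `I` in the Rees algebra of `I`. -/
theorem mem_map_algebraMap_iff (p : reesAlgebra I) :
    p ∈ I.map (algebraMap R (reesAlgebra I)) ↔ ∀ n, (p : Polynomial R).coeff n ∈ I ^ (n + 1) := by
  constructor
  · intro hp
    induction hp using Submodule.span_induction with
    | mem x hx =>
      obtain ⟨a, ha, rfl⟩ := hx
      intro n
      change (Polynomial.C a).coeff n ∈ _
      rw [Polynomial.coeff_C]
      split_ifs with h
      · simpa [h] using ha
      · exact zero_mem _
    | zero => simp
    | add x y _ _ hx hy => intro n; simpa using add_mem (hx n) (hy n)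
    | smul c x _ hx =>
      intro n
      rw [smul_eq_mul, MulMemClass.coe_mul, Polynomial.coeff_mul]
      refine Ideal.sum_mem _ fun e he => ?_
      have h1 := Ideal.mul_mem_mul (c.2 e.1) (hx e.2)
      rwa [← pow_add, ← add_assoc, Finset.HasAntidiagonal.mem_antidiagonal.mp he] at h1
  · intro h
    rw [← sum_component I p]
    refine Ideal.sum_mem _ fun n _ => ?_
    -- For `a ∈ I` and `b ∈ Iⁿ`, `ab tⁿ = a · (b tⁿ)`. The proof `hc'` stays quantified because it
    -- is part of the element and must vary in the induction.
    have key : ∀ c (hc : c ∈ I ^ (n + 1)), ∀ hc' : c ∈ I ^ n,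
        (⟨Polynomial.monomial n c, reesAlgebra.monomial_mem.mpr hc'⟩ : reesAlgebra I) ∈
          I.map (algebraMap R (reesAlgebra I)) := by
      intro c hc
      rw [pow_succ'] at hc
      induction hc using Submodule.mul_induction_on' with
      | mem_mul_mem a ha b hb =>
        intro hc'
        have : (⟨Polynomial.monomial n (a * b), reesAlgebra.monomial_mem.mpr hc'⟩ :
            reesAlgebra I) = algebraMap R (reesAlgebra I) a *
              ⟨Polynomial.monomial n b, reesAlgebra.monomial_mem.mpr hb⟩ := by
          apply Subtype.ext
          exact (Polynomial.C_mul_monomial).symm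
        rw [this]
        exact Ideal.mul_mem_right _ _ (Ideal.mem_map_of_mem _ ha)
      | add x hx y hy hx' hy' =>
        intro hc'
        rw [← pow_succ'] at hx hy
        have hxn := Ideal.pow_le_pow_right (Nat.le_succ n) hx
        have hyn := Ideal.pow_le_pow_right (Nat.le_succ n) hy
        have := add_mem (hx' hxn) (hy' hyn)
        convert this using 1
        apply Subtype.ext
        exact map_add _ _ _
    exact key _ (h n) (p.2 n)

/-- Multiplication by `f t` moves the coefficient in degree `n` to degree `n + 1` with a factor `f`,
where the colon property cancels it. -/
theorem mem_map_of_mul_degreeOne_mem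
    (h : ∀ (n : ℕ) (b : R), f * b ∈ I ^ (n + 1) → b ∈ I ^ n) {p : reesAlgebra I}
    (hp : degreeOne f hf * p ∈ I.map (algebraMap R (reesAlgebra I))) :
    p ∈ I.map (algebraMap R (reesAlgebra I)) := by
  rw [mem_map_algebraMap_iff] at hp ⊢
  intro n
  have h1 := hp (n + 1)
  have h2 : ((degreeOne f hf * p : reesAlgebra I) : Polynomial R).coeff (n + 1) =
      f * (p : Polynomial R).coeff n := by
    exact Polynomial.coeff_monomial_mul _ 1 n f
  rw [h2] at h1
  exact h _ _ h1

/-- If `f t` is not a zero divisor modulo `I`, the chart of the blowing up given by `f` meets the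
exceptional divisor in a dense subset. -/
theorem mem_closure_basicOpen_inter
    (h : ∀ (n : ℕ) (b : R), f * b ∈ I ^ (n + 1) → b ∈ I ^ n) (x : Proj (piece I))
    (hx : ∀ a ∈ I, algebraMap R (reesAlgebra I) a ∈ x.asHomogeneousIdeal) :
    x ∈ closure ({y : Proj (piece I) | y ∈ Proj.basicOpen (piece I) (degreeOne f hf) ∧
      ∀ a ∈ I, algebraMap R (reesAlgebra I) a ∈ y.asHomogeneousIdeal} : Set (Proj (piece I))) := by
  rw [(Proj.isBasis_basicOpen (piece I)).mem_closure_iff]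
  rintro _ ⟨_, ⟨s, rfl⟩, rfl⟩ hxs
  set J : Ideal (reesAlgebra I) := I.map (algebraMap R (reesAlgebra I))
  have hJx : J ≤ x.asHomogeneousIdeal.toIdeal := Ideal.map_le_iff_le_comap.mpr hx
  -- The irrelevant element `a` is carried along so that the prime found below is a point of `Proj`.
  obtain ⟨a, ha, hax⟩ := SetLike.not_le_iff_exists.mp x.not_irrelevant_le
  have hJ : J.IsHomogeneous (piece I) := by
    refine Ideal.homogeneous_span _ _ ?_
    rintro _ ⟨r, -, rfl⟩
    exact ⟨0, SetLike.algebraMap_mem_graded (piece I) r⟩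
  have hpow : ∀ (n : ℕ) (p : reesAlgebra I), degreeOne f hf ^ n * p ∈ J → p ∈ J := by
    intro n
    induction n with
    | zero => intro p hp; simpa using hp
    | succ n ih =>
      intro p hp
      rw [pow_succ', mul_assoc] at hp
      exact ih p (mem_map_of_mul_degreeOne_mem hf h hp)
  -- The powers of `f t` cancel modulo `J`, leaving `(s a)ⁿ ∈ J ⊆ x`, which is impossible.
  have hrad : degreeOne f hf * (s * a) ∉ J.radical := by
    rintro ⟨n, hn⟩
    rw [mul_pow] at hn
    have h1 := hJx (hpow n _ hn)
    have hprime := x.isPrime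
    rcases hprime.mem_or_mem (hprime.mem_of_pow_mem n h1) with h2 | h2
    · exact hxs h2
    · exact hax h2
  -- The radical is an intersection of homogeneous primes, so one containing `J` omits `f t`, `s`
  -- and `a`.
  rw [hJ.radical_eq, Submodule.mem_sInf] at hrad
  push Not at hrad
  obtain ⟨P, ⟨hPh, hJP, hPp⟩, hP⟩ := hrad
  have hP1 : degreeOne f hf ∉ P := fun h => hP (Ideal.mul_mem_right _ _ h)
  have hP2 : s ∉ P := fun h => hP (Ideal.mul_mem_left _ _ (Ideal.mul_mem_right _ _ h))
  have hP3 : a ∉ P := fun h => hP (Ideal.mul_mem_left _ _ (Ideal.mul_mem_left _ _ h))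
  exact ⟨⟨⟨P, hPh⟩, hPp, fun hle => hP3 (hle ha)⟩, hP2, hP1,
    fun r hr => hJP (Ideal.mem_map_of_mem _ hr)⟩

end ReesGrading

/-! ### The exceptional divisor in terms of homogeneous primes -/

namespace AlgebraicGeometry.Proj

open HomogeneousLocalization

theorem toSpecZero_mem_basicOpen_iff {A : Type} [CommRing A] {σ : Type*} [SetLike σ A]
    [AddSubgroupClass σ A] (𝒜 : ℕ → σ) [GradedRing 𝒜] (x : Proj 𝒜) (a : 𝒜 0) :
    toSpecZero 𝒜 x ∈ PrimeSpectrum.basicOpen a ↔ (a : A) ∉ x.asHomogeneousIdeal := by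
  obtain ⟨n, hn, s, hsn, y, rfl⟩ : ∃ (n : ℕ) (hn : 0 < n) (s : A) (hsn : s ∈ 𝒜 n)
      (y : Spec (.of (Away 𝒜 s))), awayι 𝒜 s hsn hn y = x := by
    obtain ⟨⟨n, s⟩, y, hy⟩ := (affineOpenCover 𝒜).openCover.exists_eq x
    exact ⟨n, n.2, s, s.2, y, hy⟩
  have hs : awayι 𝒜 s hsn hn y ∈ basicOpen 𝒜 s := by
    rw [← opensRange_awayι 𝒜 s hsn hn]
    exact ⟨y, rfl⟩
  -- `awayι_preimage_basicOpen` needs positive degree, so `a` is replaced by `a s`, which cuts out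
  -- the same open subset of the chart of `s`.
  have hmem : (a : A) * s ∈ 𝒜 n := by
    simpa using SetLike.mul_mem_graded a.2 hsn
  have h1 := awayι_preimage_basicOpen 𝒜 hsn hn hmem hn
  have h2 : Away.isLocalizationElem hsn hmem = fromZeroRingHom 𝒜 _ a ^ n := by
    apply HomogeneousLocalization.val_injective
    rw [HomogeneousLocalization.val_pow, Away.val_mk]
    change _ = (Localization.mk (a : A) 1) ^ n
    rw [Localization.mk_pow, Localization.mk_eq_mk_iff, Localization.r_iff_exists]
    exact ⟨1, by simp; ring⟩
  rw [h2, PrimeSpectrum.basicOpen_pow _ _ hn] at h1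
  have h3 : awayι 𝒜 s hsn hn y ∈ basicOpen 𝒜 ((a : A) * s) ↔
      y ∈ PrimeSpectrum.basicOpen (fromZeroRingHom 𝒜 (Submonoid.powers s) a) := by
    rw [← h1]; rfl
  rw [basicOpen_mul] at h3
  have h4 : toSpecZero 𝒜 (awayι 𝒜 s hsn hn y) =
      Spec.map (CommRingCat.ofHom (fromZeroRingHom 𝒜 _)) y := by
    rw [← awayι_toSpecZero 𝒜 s hsn hn]; rfl
  rw [h4]
  refine Iff.trans ?_ (h3.symm.trans ⟨fun h => h.1, fun h => ⟨h, hs⟩⟩)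
  rfl

end AlgebraicGeometry.Proj

theorem isoSpec_inv_mem_basicOpen_iff (X : Scheme.{0}) [IsAffine X] (a : Γ(X, ⊤))
    (z : Spec Γ(X, ⊤)) : X.isoSpec.inv z ∈ X.basicOpen a ↔ z ∈ PrimeSpectrum.basicOpen a := by
  have h : X.isoSpec.hom (X.isoSpec.inv z) = z := by
    rw [← Scheme.Hom.comp_apply, Iso.inv_hom_id]
    rfl
  rw [← Scheme.map_PrimeSpectrum_basicOpen_of_affine]
  change X.isoSpec.hom (X.isoSpec.inv z) ∈ PrimeSpectrum.basicOpen a ↔ _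
  rw [h]

theorem AlgebraicGeometry.Proj.toSpecZero_comp_isoSpec_inv_mem_basicOpen_iff {A : Type} [CommRing A]
    {σ : Type*} [SetLike σ A] [AddSubgroupClass σ A] (𝒜 : ℕ → σ) [GradedRing 𝒜] (X : Scheme.{0})
    [IsAffine X] (ψ : Γ(X, ⊤) →+* 𝒜 0) (x : Proj 𝒜) (a : Γ(X, ⊤)) :
    (Proj.toSpecZero 𝒜 ≫ Spec.map (CommRingCat.ofHom ψ) ≫ X.isoSpec.inv) x ∈ X.basicOpen a ↔
      (ψ a : A) ∉ x.asHomogeneousIdeal := by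
  rw [← Proj.toSpecZero_mem_basicOpen_iff]
  exact isoSpec_inv_mem_basicOpen_iff X a _

theorem mem_exceptionalSet_iff (X : Scheme.{0}) [IsAffine X] (I : Ideal Γ(X, ⊤))
    (x : Proj (ReesGrading.piece I)) : (x : blowup X I) ∈ exceptionalSet X I ↔
      ∀ a ∈ I, algebraMap Γ(X, ⊤) (reesAlgebra I) a ∈ x.asHomogeneousIdeal := by
  refine (Scheme.mem_zeroLocus_iff X (I : Set Γ(X, ⊤)) _).trans ?_
  refine forall₂_congr fun a _ => ?_
  rw [← not_iff_not, not_not]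
  exact Proj.toSpecZero_comp_isoSpec_inv_mem_basicOpen_iff (ReesGrading.piece I) X
    (algebraMap Γ(X, ⊤) (ReesGrading.piece I 0)) x a

/-! ### Coordinate rings -/

section CoordinateRings

/-- Functions on `Q × 𝔸ⁿ` are polynomials. -/
noncomputable def polynomialEquiv (n : Type) (Q : Scheme.{0}) [IsAffine Q] :
    MvPolynomial n Γ(Q, ⊤) ≃+* Γ(𝔸(n; Q), ⊤) :=
  ((Scheme.ΓSpecIso (.of (MvPolynomial n Γ(Q, ⊤)))).symm ≪≫
    Scheme.Γ.mapIso (AffineSpace.isoOfIsAffine n Q).symm.op.symm).commRingCatIsoToRingEquiv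

theorem polynomialEquiv_apply (n : Type) (Q : Scheme.{0}) [IsAffine Q]
    (p : MvPolynomial n Γ(Q, ⊤)) : polynomialEquiv n Q p =
      MvPolynomial.eval₂Hom (𝔸(n; Q) ↘ Q).appTop.hom (AffineSpace.coord Q) p := by
  have : (Scheme.ΓSpecIso (.of (MvPolynomial n Γ(Q, ⊤)))).inv ≫
      (AffineSpace.isoOfIsAffine n Q).hom.appTop = CommRingCat.ofHom
        (MvPolynomial.eval₂Hom (𝔸(n; Q) ↘ Q).appTop.hom (AffineSpace.coord Q)) := by
    rw [AffineSpace.isoOfIsAffine_hom_appTop, Iso.inv_hom_id_assoc]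
  exact congr($(this).hom p)

/-- If `h g = 0`, the locus where `h` is invertible misses a dense set, so it is empty and `h = 0`
by reducedness. -/
theorem mem_nonZeroDivisors_of_dense {X : Scheme.{0}} [IsReduced X] (g : Γ(X, ⊤))
    (hg : Dense (X.basicOpen g : Set X)) : g ∈ nonZeroDivisors Γ(X, ⊤) := by
  rw [mem_nonZeroDivisors_iff_right]
  intro h hgh
  have h1 : X.basicOpen h = ⊥ := by
    by_contra hne
    obtain ⟨x, hx⟩ := (Opens.ne_bot_iff_nonempty _).mp hne
    obtain ⟨y, hy, hy'⟩ := hg.inter_open_nonempty _ (X.basicOpen h).isOpen ⟨x, hx⟩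
    have : y ∈ X.basicOpen (h * g) := by rw [Scheme.basicOpen_mul]; exact ⟨hy, hy'⟩
    rw [hgh, Scheme.basicOpen_zero] at this
    exact this
  exact eq_zero_of_basicOpen_eq_bot h h1

end CoordinateRings

/-! ### Affine modifications of affine spaces -/

theorem RingHom.exists_ringEquiv_of_range_eq {C B K : Type*} [CommRing C] [CommRing B]
    [CommRing K] (a : C →+* K) (b : B →+* K) (ha : Function.Injective a)
    (hb : Function.Injective b) (h : Set.range a = Set.range b) :
    ∃ e : C ≃+* B, ∀ c, b (e c) = a c := by
  have h1 : ∀ c, ∃ x, b x = a c := fun c => h.subset ⟨c, rfl⟩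
  choose F hF using h1
  let F' : C →+* B :=
    { toFun := F
      map_one' := hb (by rw [hF, map_one, map_one])
      map_mul' := fun x y => hb (by rw [hF, map_mul, map_mul, hF, hF])
      map_zero' := hb (by rw [hF, map_zero, map_zero])
      map_add' := fun x y => hb (by rw [hF, map_add, map_add, hF, hF]) }
  refine ⟨RingEquiv.ofBijective F' ⟨fun x y hxy => ha ?_, fun x => ?_⟩, hF⟩
  · rw [← hF, ← hF]
    exact congrArg b hxy
  · obtain ⟨c, hc⟩ := h.superset ⟨x, rfl⟩
    exact ⟨c, hb ((hF c).trans hc)⟩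

/-- If every element of `B` becomes an element of `R ⊆ B` after multiplication by a power of `g`,
a homomorphism from `R` that inverts `g` extends to `B`. -/
theorem RingHom.exists_extension_of_isUnit {R B K : Type*} [CommRing R] [CommRing B] [CommRing K]
    (ψ : R →+* B) (hψ : Function.Injective ψ) (g : R)
    (hloc : ∀ b : B, ∃ (n : ℕ) (r : R), ψ g ^ n * b = ψ r) (μ : R →+* K) (hμ : IsUnit (μ g)) :
    ∃ j : B →+* K, ∀ r, j (ψ r) = μ r := by
  obtain ⟨w, hw⟩ := hμ.exists_left_inv
  choose n p hp using hloc
  have hwn : ∀ i, w ^ i * μ g ^ i = 1 := fun i => by rw [← mul_pow, hw, one_pow]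
  -- The value does not depend on the fraction representing `b`, so each ring law needs only one
  -- suitable fraction.
  have key : ∀ b i r, ψ g ^ i * b = ψ r → w ^ n b * μ (p b) = w ^ i * μ r := by
    intro b i r h
    have h1 : g ^ i * p b = g ^ n b * r := hψ (by
      rw [map_mul, map_mul, map_pow, map_pow, ← hp, ← h]; ring)
    have h2 := congrArg μ h1
    rw [map_mul, map_mul, map_pow, map_pow] at h2
    calc w ^ n b * μ (p b) = w ^ n b * μ (p b) * (w ^ i * μ g ^ i) := by rw [hwn, mul_one]
      _ = w ^ n b * w ^ i * (μ g ^ i * μ (p b)) := by ring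
      _ = w ^ i * μ r * (w ^ n b * μ g ^ n b) := by rw [h2]; ring
      _ = w ^ i * μ r := by rw [hwn, mul_one]
  have hψ' : ∀ r, w ^ n (ψ r) * μ (p (ψ r)) = μ r := fun r => by
    rw [key (ψ r) 0 r (by simp), pow_zero, one_mul]
  refine ⟨{ toFun := fun b => w ^ n b * μ (p b), map_one' := ?_, map_mul' := fun b c => ?_,
            map_zero' := ?_, map_add' := fun b c => ?_ }, hψ'⟩
  · rw [← map_one ψ, hψ', map_one]
  · rw [key (b * c) (n b + n c) (p b * p c) (by rw [map_mul, ← hp, ← hp]; ring), map_mul]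
    ring
  · rw [← map_zero ψ, hψ', map_zero]
  · rw [key (b + c) (n b + n c) (g ^ n c * p b + g ^ n b * p c)
      (by rw [map_add, map_mul, map_mul, ← hp, ← hp, map_pow, map_pow]; ring), map_add, map_mul,
      map_mul, map_pow, map_pow]
    linear_combination (w ^ n b * μ (p b)) * hwn (n c) + (w ^ n c * μ (p c)) * hwn (n b)

open MvPolynomial HomogeneousLocalization ReesGrading in
/-- For an affine modification of `A[u₁, …, uₘ]` with divisor `g`, the chart of the blowing up of
`(u₁, …, uₘ, f)` given by `f` is isomorphic to the modification itself when `f` is congruent to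
`1` modulo a high power of `g`. -/
theorem exists_chart_equiv {A B : Type} [CommRing A] [CommRing B] {σ : Type}
    (ψ : MvPolynomial σ A →+* B) (hψ : Function.Injective ψ) (g : A) (hg : g ∈ nonZeroDivisors A)
    (hgB : ψ (C g) ∈ nonZeroDivisors B)
    (hloc : ∀ b : B, ∃ (n : ℕ) (p : MvPolynomial σ A), ψ (C g) ^ n * b = ψ p)
    (hft : (ψ.comp C).FiniteType) :
    ∃ k₀ : ℕ, ∀ k, k₀ ≤ k → ∀ f ∈ nonZeroDivisors A, g ^ k ∣ f - 1 →
      ∀ I : Ideal B, I = Ideal.span (Set.range (fun i => ψ (X i)) ∪ {ψ (C f)}) →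
      (∀ (n : ℕ) (b : B), ψ (C f) * b ∈ I ^ (n + 1) → b ∈ I ^ n) ∧
      ∃ (hf : ψ (C f) ∈ I) (e : Away (piece I) (degreeOne (ψ (C f)) hf) ≃+* B),
        ∀ a : A, e (fromZeroRingHom (piece I) _ (algebraMap B (piece I 0) (ψ (C a)))) =
          ψ (C a) := by
  let L := FractionRing A
  let K := MvPolynomial σ L
  have hinj : Function.Injective (algebraMap A L) := IsFractionRing.injective A L
  have hunit : ∀ a ∈ nonZeroDivisors A, IsUnit (algebraMap A L a) := fun a ha =>
    IsLocalization.map_units L (⟨a, ha⟩ : nonZeroDivisors A)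
  obtain ⟨j₀, hj₀⟩ := ψ.exists_extension_of_isUnit hψ (C g) hloc
    (MvPolynomial.map (algebraMap A L)) (by rw [map_C]; exact (hunit g hg).map C)
  have hj₀inj : Function.Injective j₀ := by
    rw [injective_iff_map_eq_zero]
    intro b hb
    obtain ⟨n, p, hp⟩ := hloc b
    have h1 : p = 0 := by
      apply MvPolynomial.map_injective _ hinj
      rw [← hj₀, ← hp, map_mul, hb, mul_zero, map_zero]
    rw [h1, map_zero, mul_comm] at hp
    exact (mem_nonZeroDivisors_iff_right.mp (pow_mem hgB n)) b hp
  let : Algebra A B := (ψ.comp C).toAlgebra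
  have halg : ∀ a, algebraMap A B a = ψ (C a) := fun _ => rfl
  let j : B →ₐ[A] K :=
    { j₀ with
      commutes' := fun a => by
        change j₀ (ψ (C a)) = _
        rw [hj₀, map_C]; rfl }
  obtain ⟨T, hT⟩ := (show Algebra.FiniteType A B from hft).out
  choose n p hp using hloc
  -- The supremum bounds the denominators of all generators; the `+ 1` forces `k ≠ 0`, so `g ∣ f -
  -- 1` and `f`, `g` are comaximal.
  refine ⟨T.sup n + 1, fun k hk f hf hfg I hI => ?_⟩
  have hfI : ψ (C f) ∈ I := by rw [hI]; exact Ideal.subset_span (Or.inr rfl)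
  have hImap : I = (Ideal.span (Set.range X ∪ {C f})).map ψ := by
    rw [hI, Ideal.map_span, Set.image_union, Set.image_singleton, ← Set.range_comp]
    rfl
  obtain ⟨v, hv⟩ := (hunit f hf).exists_left_inv
  refine ⟨fun n b hb => ?_, hfI, ?_⟩
  · rw [hImap] at hb ⊢
    refine Ideal.mem_map_pow_of_mul_mem ψ hψ (C g) (C f) (fun b => ⟨_, _, hp b⟩) _
      (Ideal.subset_span (Or.inr rfl)) ?_
      (fun n p h => mem_span_X_C_pow_of_mul_mem hf h) n b hb
    obtain ⟨c, hc⟩ := (dvd_pow_self g (by omega : k ≠ 0)).trans hfg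
    refine IsCoprime.map (f := (C : A →+* MvPolynomial σ A)) ⟨1, -c, ?_⟩
    linear_combination hc
  · have hv' : (C v : K) * j.toRingHom (ψ (C f)) = 1 := by
      change C v * j₀ (ψ (C f)) = 1
      rw [hj₀, map_C, ← C_mul, hv, C_1]
    have hjX : ∀ i, j (ψ (X i)) = X i := fun i => (hj₀ _).trans (map_X _ _)
    have hr := range_chartMap_eq_adjoin hfI j hv' (fun i => ψ (X i)) hI (T : Set B) hT
    simp only [hjX] at hr
    have hσ := map_dilation_adjoin (A := A) (L := L) j (fun i => ψ (X i)) hjX f g v hv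
      (hunit g hg) (T : Set B) hT (T.sup n) k (fun b hb => by
        have hle : n b ≤ T.sup n := Finset.le_sup hb
        refine ⟨C g ^ (T.sup n - n b) * p b, ?_⟩
        have h1 := congrArg j₀ (hp b)
        rw [map_mul, map_pow, hj₀, hj₀, map_C] at h1
        rw [map_mul, ← h1, map_pow, map_C, ← mul_assoc, ← pow_add, Nat.sub_add_cancel hle]
        rfl) (by omega) hfg
    obtain ⟨e, he⟩ := RingHom.exists_ringEquiv_of_range_eq
      ((dilation A f : K →ₐ[A] K).toRingHom.comp (chartMap j.toRingHom hfI hv')) j.toRingHom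
      ((dilation_injective (hunit f hf)).comp (chartMap_injective _ hfI hv' hj₀inj)) hj₀inj (by
        rw [RingHom.coe_comp, Set.range_comp, hr]
        exact congrArg (SetLike.coe (B := K)) hσ)
    refine ⟨e, fun a => hj₀inj ?_⟩
    refine (he _).trans ?_
    rw [RingHom.comp_apply, chartMap_fromZeroRingHom]
    change dilation A f (j₀ (ψ (C a))) = j₀ (ψ (C a))
    rw [hj₀, map_C, dilation_C]

/-! ### Functions on an affine modification away from its divisor -/

theorem AlgebraicGeometry.Scheme.exists_pow_mul_eq_zero {X : Scheme.{0}} [IsAffine X]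
    (g h : Γ(X, ⊤))
    (hh : X.presheaf.map (homOfLE (X.basicOpen_le g)).op h = 0) : ∃ n : ℕ, g ^ n * h = 0 := by
  have hloc : IsLocalization.Away g Γ(X, X.basicOpen g) :=
    (isAffineOpen_top X).isLocalization_basicOpen g
  obtain ⟨⟨_, n, rfl⟩, hc⟩ := (IsLocalization.map_eq_zero_iff (Submonoid.powers g)
    Γ(X, X.basicOpen g) h).mp hh
  exact ⟨n, hc⟩

theorem AlgebraicGeometry.Scheme.app_basicOpen_map {X Y : Scheme.{0}} (φ : X ⟶ Y)
    (g r : Γ(Y, ⊤)) :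
    φ.app (Y.basicOpen g) (Y.presheaf.map (homOfLE (Y.basicOpen_le g)).op r) =
      X.presheaf.map (homOfLE (show φ ⁻¹ᵁ Y.basicOpen g ≤ ⊤ from le_top)).op (φ.appTop r) :=
  congr($(φ.naturality (homOfLE (Y.basicOpen_le g)).op).hom r)

namespace IsAffineModification

variable {X Y : Scheme.{0}} {φ : X ⟶ Y} {g : Γ(Y, ⊤)}

theorem isIso_app (h : IsAffineModification φ g) : IsIso (φ.app (Y.basicOpen g)) := by
  have := h.isIso_restrict
  have h1 : IsIso (φ ∣_ Y.basicOpen g).appTop :=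
    inferInstanceAs (IsIso (Scheme.Γ.map (φ ∣_ Y.basicOpen g).op))
  rw [morphismRestrict_appTop] at h1
  have h2 : IsIso (φ.app ((Y.basicOpen g).ι ''ᵁ ⊤)) := (isIso_comp_right_iff _ (X.presheaf.map
    (eqToHom (image_morphismRestrict_preimage φ (Y.basicOpen g) ⊤)).op)).mp h1
  rwa [Scheme.Opens.ι_image_top] at h2

theorem map_mem_nonZeroDivisors [IsReduced X] (h : IsAffineModification φ g) :
    φ.appTop g ∈ nonZeroDivisors Γ(X, ⊤) := by
  apply mem_nonZeroDivisors_of_dense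
  have := h.dense_source
  rwa [Scheme.preimage_basicOpen] at this

theorem appTop_injective [IsAffine Y] (h : IsAffineModification φ g)
    (hg : g ∈ nonZeroDivisors Γ(Y, ⊤)) : Function.Injective φ.appTop.hom := by
  rw [injective_iff_map_eq_zero]
  intro r hr
  have h1 : Y.presheaf.map (homOfLE (Y.basicOpen_le g)).op r = 0 := by
    apply ((ConcreteCategory.isIso_iff_bijective (φ.app (Y.basicOpen g))).mp h.isIso_app).1
    rw [Scheme.app_basicOpen_map, map_zero]
    exact (congrArg _ hr).trans (map_zero _)
  obtain ⟨n, hn⟩ := Scheme.exists_pow_mul_eq_zero g r h1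
  rw [mul_comm] at hn
  exact mem_nonZeroDivisors_iff_right.mp (pow_mem hg n) r hn

/-- Off the divisor `b` is the pullback of a fraction `r / gⁿ`; equality there holds globally after
multiplying by a further power of `g`. -/
theorem exists_pow_mul_eq [IsAffine X] [IsAffine Y] (h : IsAffineModification φ g)
    (b : Γ(X, ⊤)) : ∃ (n : ℕ) (r : Γ(Y, ⊤)), φ.appTop g ^ n * b = φ.appTop r := by
  obtain ⟨y, hy⟩ := ((ConcreteCategory.isIso_iff_bijective (φ.app (Y.basicOpen g))).mp
    h.isIso_app).2 (X.presheaf.map (homOfLE (show φ ⁻¹ᵁ Y.basicOpen g ≤ ⊤ from le_top)).op b)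
  have hloc : IsLocalization.Away g Γ(Y, Y.basicOpen g) :=
    (isAffineOpen_top Y).isLocalization_basicOpen g
  obtain ⟨n, r, hr⟩ := IsLocalization.Away.surj g y
  have hr' : y * Y.presheaf.map (homOfLE (Y.basicOpen_le g)).op (g ^ n) =
      Y.presheaf.map (homOfLE (Y.basicOpen_le g)).op r := by
    rw [map_pow]; exact hr
  have h1 := congrArg (φ.app (Y.basicOpen g)) hr'
  rw [map_mul, Scheme.app_basicOpen_map, Scheme.app_basicOpen_map, hy, ← map_mul,
    ← sub_eq_zero, ← map_sub] at h1
  obtain ⟨k, hk⟩ := Scheme.exists_pow_mul_eq_zero (φ.appTop g)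
    (b * φ.appTop (g ^ n) - φ.appTop r) (by
      have h2 := congrArg (X.presheaf.map
        (eqToHom (Scheme.preimage_basicOpen_top φ g).symm).op) h1
      rw [map_zero, ← ConcreteCategory.comp_apply, ← Functor.map_comp] at h2
      exact h2)
  refine ⟨k + n, g ^ k * r, ?_⟩
  rw [map_pow] at hk
  rw [map_mul, map_pow]
  linear_combination hk

end IsAffineModification

/-! ### The chart as an open subscheme, and the main theorem -/

/-- Only functions from `Q` are assumed fixed by `e`, as the dilation moves the `uᵢ`; so
compatibility is asserted only after mapping to `Q` and on to `S`. -/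
theorem AlgebraicGeometry.Proj.exists_iso_basicOpen {A σ : Type} [CommRing A] [SetLike σ A]
    [AddSubgroupClass σ A] (𝒜 : ℕ → σ) [GradedRing 𝒜] {X Q : Scheme.{0}} [IsAffine X] [IsAffine Q]
    (q : X ⟶ Q) (ι : Γ(X, ⊤) →+* 𝒜 0) {s : A} {n : ℕ} (hs : s ∈ 𝒜 n) (hn : 0 < n)
    (e : HomogeneousLocalization.Away 𝒜 s ≃+* Γ(X, ⊤))
    (he : ∀ a : Γ(Q, ⊤), e (HomogeneousLocalization.fromZeroRingHom 𝒜 _ (ι (q.appTop a))) =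
      q.appTop a) :
    ∃ E : (Proj.basicOpen 𝒜 s).toScheme ≅ X, ∀ {S : Scheme.{0}} (t : Q ⟶ S),
      E.hom ≫ q ≫ t = (Proj.basicOpen 𝒜 s).ι ≫ (Proj.toSpecZero 𝒜 ≫
        Spec.map (CommRingCat.ofHom ι) ≫ X.isoSpec.inv) ≫ q ≫ t := by
  refine ⟨Proj.basicOpenIsoSpec 𝒜 s hs hn ≪≫
    Scheme.Spec.mapIso e.symm.toCommRingCatIso.op.symm.symm ≪≫ X.isoSpec.symm, fun t => ?_⟩
  have h1 : (Proj.basicOpen 𝒜 s).ι =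
      (Proj.basicOpenIsoSpec 𝒜 s hs hn).hom ≫ Proj.awayι 𝒜 s hs hn := by
    rw [← Proj.basicOpenIsoSpec_inv_ι, Iso.hom_inv_id_assoc]
  rw [h1]
  simp only [Iso.trans_hom, Category.assoc, Proj.awayι_toSpecZero_assoc]
  congr 1
  change Spec.map (CommRingCat.ofHom e.symm.toRingHom) ≫ X.isoSpec.inv ≫ q ≫ t = _
  rw [← Scheme.isoSpec_inv_naturality_assoc, ← Spec.map_comp_assoc, ← Spec.map_comp_assoc,
    ← Spec.map_comp_assoc]
  congr 2
  ext a
  exact congrArg HomogeneousLocalization.val (e.symm_apply_eq.mpr (he a).symm)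

theorem theorem4 {Q X : Scheme.{0}}
    (sQ : Q ⟶ Spec (CommRingCat.of ℂ)) [IsAffine Q] [IsReduced Q] [LocallyOfFiniteType sQ]
    (sX : X ⟶ Spec (CommRingCat.of ℂ)) [IsAffine X] [IsReduced X] [LocallyOfFiniteType sX]
    (m : ℕ) (φ : X ⟶ 𝔸(Fin m; Q)) (hφ : φ ≫ (𝔸(Fin m; Q) ↘ Q) ≫ sQ = sX)
    (g : Γ(Q, ⊤)) (hg : IsAffineModification φ (liftFun m g)) :
    ∃ k₀ : ℕ, ∀ k : ℕ, k₀ ≤ k → ∀ f : Γ(Q, ⊤),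
      Dense (Q.basicOpen f : Set Q) →
      Disjoint (Q.zeroLocus {f}) (Q.zeroLocus {g}) →
      g ^ k ∣ f - 1 →
      ∃ X' : (blowup X (preimageIdeal φ f)).Opens,
        (∃ e : X'.toScheme ≅ X,
          e.hom ≫ sX = X'.ι ≫ blowupπ X (preimageIdeal φ f) ≫ sX) ∧
        exceptionalSet X (preimageIdeal φ f) ⊆
          closure ((X' : Set (blowup X (preimageIdeal φ f))) ∩
            exceptionalSet X (preimageIdeal φ f)) := by
  let q : X ⟶ Q := φ ≫ (𝔸(Fin m; Q) ↘ Q)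
  have hq : q ≫ sQ = sX := by rw [← hφ]; exact Category.assoc _ _ _
  let ρ := polynomialEquiv (Fin m) Q
  have hρC : ∀ a, ρ (MvPolynomial.C a) = liftFun m a := fun a => by
    rw [polynomialEquiv_apply]; exact MvPolynomial.eval₂_C _ _ _
  have hρX : ∀ i, ρ (MvPolynomial.X i) = AffineSpace.coord Q i := fun i => by
    rw [polynomialEquiv_apply]; exact MvPolynomial.eval₂_X _ _ _
  let ψ : MvPolynomial (Fin m) Γ(Q, ⊤) →+* Γ(X, ⊤) := φ.appTop.hom.comp ρ.toRingHom
  have hψC : ∀ a, ψ (MvPolynomial.C a) = φ.appTop (liftFun m a) := fun a =>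
    congrArg φ.appTop (hρC a)
  have hψX : ∀ i, ψ (MvPolynomial.X i) = φ.appTop (AffineSpace.coord Q i) := fun i =>
    congrArg φ.appTop (hρX i)
  have hψq : ∀ a, ψ (MvPolynomial.C a) = q.appTop a := fun a => by
    rw [hψC]
    exact congr($(Scheme.Hom.comp_appTop φ (𝔸(Fin m; Q) ↘ Q)).hom a).symm
  have hg' : liftFun m g ∈ nonZeroDivisors Γ(𝔸(Fin m; Q), ⊤) :=
    mem_nonZeroDivisors_of_dense _ hg.dense_target
  have hgA : g ∈ nonZeroDivisors Γ(Q, ⊤) := by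
    rw [mem_nonZeroDivisors_iff_right]
    intro a ha
    have h1 := mem_nonZeroDivisors_iff_right.mp hg' (liftFun m a) (by
      rw [← hρC, ← hρC, ← map_mul, ← MvPolynomial.C_mul, ha, MvPolynomial.C_0, map_zero])
    rw [← hρC, map_eq_zero_iff ρ ρ.injective] at h1
    exact (MvPolynomial.C_injective _ _) (h1.trans MvPolynomial.C_0.symm)
  -- Finite type over `ℂ` gives finite type over `Q`, hence finitely many denominators to bound.
  have hft : (ψ.comp MvPolynomial.C).FiniteType := by
    have : LocallyOfFiniteType (q ≫ sQ) := by rw [hq]; infer_instance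
    have h1 : LocallyOfFiniteType q := locallyOfFiniteType_of_comp q sQ
    have h2 : ψ.comp MvPolynomial.C = q.appTop.hom := RingHom.ext hψq
    rw [h2]
    exact (HasRingHomProperty.iff_of_isAffine (P := @LocallyOfFiniteType)).mp h1
  obtain ⟨k₀, hk₀⟩ := exists_chart_equiv ψ
    ((hg.appTop_injective hg').comp ρ.injective) g hgA
    (by rw [hψC]; exact hg.map_mem_nonZeroDivisors)
    (fun b => by
      obtain ⟨n, r, hr⟩ := hg.exists_pow_mul_eq b
      refine ⟨n, ρ.symm r, ?_⟩
      rw [hψC, hr]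
      exact congrArg φ.appTop (ρ.apply_symm_apply r).symm) hft
  refine ⟨k₀, fun k hk f hf _ hfg => ?_⟩
  obtain ⟨hcolon, hfI, e, he⟩ := hk₀ k hk f (mem_nonZeroDivisors_of_dense f hf) hfg
    (preimageIdeal φ f) (by
      rw [preimageIdeal, centerIdeal, Ideal.map_span, Set.image_union, Set.image_singleton,
        ← Set.range_comp, hψC]
      simp only [hψX]
      rfl)
  refine ⟨Proj.basicOpen (ReesGrading.piece (preimageIdeal φ f))
    (ReesGrading.degreeOne _ hfI), ?_, fun x hx => ?_⟩
  · obtain ⟨E, hE⟩ := Proj.exists_iso_basicOpen (ReesGrading.piece (preimageIdeal φ f)) q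
      (algebraMap Γ(X, ⊤) (ReesGrading.piece (preimageIdeal φ f) 0))
      (ReesGrading.degreeOne_mem _ hfI) one_pos e (fun a => by
        rw [← hψq]; exact he a)
    have h1 := hE sQ
    rw [hq] at h1
    exact ⟨E, h1⟩
  · have h1 := ReesGrading.mem_closure_basicOpen_inter hfI hcolon x
      ((mem_exceptionalSet_iff X _ x).mp hx)
    exact closure_mono (fun y hy => And.intro hy.1 ((mem_exceptionalSet_iff X _ y).mpr hy.2)) h1
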